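/- Let $\kappa\ge 0$ be an integer and let $(\Pi_\kappa,\langle\cdot,\cdot\rangle)$ be a complex Pontryagin space of index $\kappa$: a complex vector space with a Hermitian form (conjugate-linear in the first argument) and a decomposition $\Pi_\kappa=\Pi^+\oplus\Pi^-$ into subspaces orthogonal for the form such that $(\Pi^+,\langle\cdot,\cdot\rangle)$ is a Hilbert space and $(\Pi^-,-\langle\cdot,\cdot\rangle)$ is a Hilbert space of dimension $\kappa$. Give $\Pi_\kappa$ the topology of the Hilbert space inner product $\langle x,y\rangle_+=\langle x_+,y_+\rangle-\langle x_-,y_-\rangle$, where $x=x_++x_-$ and $y=y_++y_-$ with $x_\pm,y_\pm\in\Pi^\pm$. Theorem (Positive compact Pontryagin space operators). Let $\mathcal A:\Pi_\kappa\to\Pi_\kappa$ be a compact linear operator that is positive, i.e. $\langle \mathcal A x,x\rangle$ is real and $\ge 0$ for all $x\in\Pi_\kappa$, and suppose that $0$ is not an eigenvalue of $\mathcal A$. Then: (i) all eigenvalues of $\mathcal A$ are real; (ii) eigenvectors belonging to distinct eigenvalues are orthogonal, and there is an orthonormal basis $(e_i)_{i\in I}$ of $\Pi_\kappa$ consisting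 of eigenvectors of $\mathcal A$: $\langle e_i,e_j\rangle=0$ for $i\neq j$, $\langle e_i,e_i\rangle=\pm1$, and every $x\in\Pi_\kappa$ has a unique expansion $x=\sum_{i\in I} c_i e_i$ with $c_i\in\mathbb C$, the sum converging unconditionally in $\Pi_\kappa$; (iii) counted with multiplicity there are exactly $\kappa$ negative eigenvalues: there are only finitely many distinct ones, their eigenspaces are finite-dimensional with dimensions adding up to $\kappa$, and the basis in (ii) can be chosen so that exactly $\kappa$ of its members belong to negative eigenvalues; (iv) all remaining eigenvalues are positive; every eigenvector $x$ of a negative eigenvalue satisfies $\langle x,x\rangle<0$ and every eigenvector $x$ of a positive eigenvalue satisfies $\langle x,x\rangle>0$. -/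

import Mathlib

open scoped ComplexConjugate

noncomputable section

/-- A Pontryagin space of index `κ`, carried by the complex vector space `E`: a Hermitian form
(conjugate-linear in the first variable) together with a fundamental decomposition
`E = pos ⊕ neg` into subspaces orthogonal for the form, such that `(pos, form)` is a Hilbert space
and `(neg, -form)` is a `κ`-dimensional Hilbert space. The decomposition serves only to define the
Hilbert topology; different decompositions of the same form have the same `κ` and induce
equivalent Hilbert norms. -/
structure PontryaginSpace (κ : ℕ) (E : Type*) [AddCommGroup E] [Module ℂ E] where
  /-- the indefinite inner product -/
  form : E →ₗ⋆[ℂ] E →ₗ[ℂ] ℂ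
  conj_symm : ∀ x y, conj (form y x) = form x y
  pos : Submodule ℂ E
  neg : Submodule ℂ E
  isCompl : IsCompl pos neg
  orthogonal : ∀ x ∈ pos, ∀ y ∈ neg, form x y = 0
  pos_def : ∀ x ∈ pos, x ≠ 0 → 0 < (form x x).re
  neg_def : ∀ x ∈ neg, x ≠ 0 → (form x x).re < 0
  /-- completeness of `pos` for the norm `x ↦ √(form x x)`: Cauchy sequences converge -/
  complete_pos : ∀ u : ℕ → E, (∀ n, u n ∈ pos) →
    (∀ ε : ℝ, 0 < ε → ∃ k, ∀ m ≥ k, ∀ n ≥ k, √(form (u m - u n) (u m - u n)).re < ε) →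
    ∃ x ∈ pos, ∀ ε : ℝ, 0 < ε → ∃ k, ∀ n ≥ k, √(form (u n - x) (u n - x)).re < ε
  finiteDimensional_neg : FiniteDimensional ℂ neg
  finrank_neg : Module.finrank ℂ neg = κ

namespace PontryaginSpace

variable {κ : ℕ} {E : Type*} [AddCommGroup E] [Module ℂ E] (P : PontryaginSpace κ E)

/-- The component `x₊` of `x` in `pos`. -/
def posPart : E →ₗ[ℂ] E := P.pos.projection P.neg P.isCompl

/-- The component `x₋` of `x` in `neg`. -/
def negPart : E →ₗ[ℂ] E := P.neg.projection P.pos P.isCompl.symm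

theorem posPart_mem (x : E) : P.posPart x ∈ P.pos :=
  Submodule.projection_apply_mem _ x

theorem negPart_mem (x : E) : P.negPart x ∈ P.neg :=
  Submodule.projection_apply_mem _ x

theorem posPart_eq_zero {x : E} : P.posPart x = 0 ↔ x ∈ P.neg :=
  Submodule.projection_apply_eq_zero_iff _

theorem negPart_eq_zero {x : E} : P.negPart x = 0 ↔ x ∈ P.pos :=
  Submodule.projection_apply_eq_zero_iff _

theorem re_form_nonneg {x : E} (hx : x ∈ P.pos) : 0 ≤ (P.form x x).re := by
  by_cases h : x = 0
  · simp [h]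
  · exact (P.pos_def x hx h).le

theorem re_form_nonpos {x : E} (hx : x ∈ P.neg) : (P.form x x).re ≤ 0 := by
  by_cases h : x = 0
  · simp [h]
  · exact (P.neg_def x hx h).le

/-- The positive-definite inner product `⟨x, y⟩₊ = ⟨x₊, y₊⟩ - ⟨x₋, y₋⟩` of the associated Hilbert
space. -/
@[reducible]
def hilbertCore : InnerProductSpace.Core ℂ E where
  inner x y := P.form (P.posPart x) (P.posPart y) - P.form (P.negPart x) (P.negPart y)
  conj_inner_symm x y := by simp only [map_sub, P.conj_symm]
  re_inner_nonneg x := by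
    have h1 := P.re_form_nonneg (P.posPart_mem x)
    have h2 := P.re_form_nonpos (P.negPart_mem x)
    simp only [RCLike.re_to_complex, Complex.sub_re]
    linarith
  add_left x y z := by
    simp only [map_add, LinearMap.add_apply]
    ring
  smul_left x y r := by
    simp only [map_smul, LinearMap.map_smulₛₗ, LinearMap.smul_apply, smul_eq_mul]
    ring
  definite x h := by
    have h1 := P.re_form_nonneg (P.posPart_mem x)
    have h2 := P.re_form_nonpos (P.negPart_mem x)
    have h3 := congrArg Complex.re h
    simp only [Complex.sub_re, Complex.zero_re] at h3
    have hp : P.posPart x = 0 := by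
      by_contra hne
      linarith [P.pos_def _ (P.posPart_mem x) hne]
    have hn : P.negPart x = 0 := by
      by_contra hne
      linarith [P.neg_def _ (P.negPart_mem x) hne]
    exact (Submodule.disjoint_def.1 P.isCompl.disjoint) x
      (P.negPart_eq_zero.1 hn) (P.posPart_eq_zero.1 hp)

/-- The Hilbert topology of the Pontryagin space: the topology of the norm `√⟨x, x⟩₊`. -/
@[reducible]
def topology : TopologicalSpace E :=
  (P.hilbertCore.toNormedAddCommGroup).toMetricSpace.toUniformSpace.toTopologicalSpace

/-- `A` is a compact operator for the Hilbert topology. -/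
def IsCompactOp (A : E →ₗ[ℂ] E) : Prop :=
  letI := P.topology
  IsCompactOperator A

/-- `A` is a positive operator: `⟨A x, x⟩` is real and nonnegative for every `x`. -/
def IsPositiveOp (A : E →ₗ[ℂ] E) : Prop :=
  ∀ x, (P.form (A x) x).im = 0 ∧ 0 ≤ (P.form (A x) x).re

/-- `e` is an orthonormal basis of the Pontryagin space: `⟨e i, e j⟩ = ± δ i j`, and every vector
has a unique expansion `x = ∑ i, c i • e i`, converging unconditionally in the Hilbert topology. -/
structure IsOrthonormalBasis {ι : Type*} (e : ι → E) : Prop where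
  orthogonal : ∀ i j, i ≠ j → P.form (e i) (e j) = 0
  normalized : ∀ i, P.form (e i) (e i) = 1 ∨ P.form (e i) (e i) = -1
  expansion : ∀ x : E, ∃! c : ι → ℂ,
    letI := P.topology
    HasSum (fun i => c i • e i) x

end PontryaginSpace

end

open Filter Topology InnerProductSpace

/-! ### Eigenvectors of a symmetry times a positive compact operator -/

section HilbertSpace

universe u

variable {H : Type u} [NormedAddCommGroup H] [InnerProductSpace ℂ H] [CompleteSpace H]

/-! Let `J` be the fundamental symmetry, so that the form is `[x, y] = ⟨x, J y⟩` for the Hilbert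
inner product. Then `B = J A` is an injective positive compact Hilbert space operator and `A = J B`.
With `T` the square root of `B`, the operator `T J T` is compact and self-adjoint, and `A (J T) = (J
T) (T J T)`. Hence `J T` carries an orthonormal eigenbasis of `T J T` to eigenvectors of `A`, which
after scaling are form-orthonormal with the signs of their eigenvalues
(`exists_form_orthonormal_eigenvectors`).

These vectors are total, but an indefinite form gives no Bessel inequality at once. At most `κ` of
them are negative, since their components in `neg` are independent. On the form-complement of these
few the form is nonnegative, which yields Bessel sums, then uniformly bounded partial sums by
Banach–Steinhaus, then unconditional convergence by density of the span. The same nonnegativity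
forces at least `κ` negative vectors.

Finally `[A x, x] > 0` for `x ≠ 0`, so each eigenvalue is real and has the sign of the form on its
eigenvectors. -/

theorem IsCompactOperator.of_isSelfAdjoint_comp_self {T : H →L[ℂ] H} (hT : IsSelfAdjoint T)
    (hc : IsCompactOperator (T ∘L T)) : IsCompactOperator T := by
  have hc' := (isCompactOperator_iff_isCompact_closure_image_ball
    ((T ∘L T : H →L[ℂ] H) : H →ₗ[ℂ] H) one_pos).1 hc
  refine (isCompactOperator_iff_isCompact_closure_image_ball (T : H →ₗ[ℂ] H) one_pos).2 ?_
  refine isCompact_iff_totallyBounded_isComplete.2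
    ⟨TotallyBounded.closure ?_, isClosed_closure.isComplete⟩
  refine Metric.totallyBounded_iff.2 fun ε hε => ?_
  -- Since `‖T z‖² = ⟨T (T z), z⟩ ≤ ‖T (T z)‖ ‖z‖` and differences of points of the unit ball have
  -- norm below `2`, an `ε² / 2`-net for `T ∘ T` gives an `ε`-net for `T`.
  obtain ⟨t, hts, htf, htc⟩ := Metric.finite_approx_of_totallyBounded
    (hc'.totallyBounded.subset subset_closure) (ε ^ 2 / 2) (by positivity)
  obtain ⟨u, hu, huf, rfl⟩ := (Set.exists_subset_image_finite_and
    (p := fun s => s = t)).1 ⟨t, hts, htf, rfl⟩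
  refine ⟨T '' u, huf.image _, ?_⟩
  rintro _ ⟨x, hx, rfl⟩
  have hx' := htc ⟨x, hx, rfl⟩
  simp only [Set.mem_iUnion, Set.mem_image, exists_prop] at hx' ⊢
  obtain ⟨_, ⟨y, hy, rfl⟩, hxy⟩ := hx'
  refine ⟨T y, ⟨y, hy, rfl⟩, ?_⟩
  have h1 : ‖x - y‖ < 2 := by
    have hx1 := mem_ball_zero_iff.1 hx
    have hy1 := mem_ball_zero_iff.1 (hu hy)
    linarith [norm_sub_le x y]
  have h2 : ‖T (T (x - y))‖ < ε ^ 2 / 2 := by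
    simpa [dist_eq_norm] using hxy
  have h3 : ‖T (x - y)‖ ^ 2 ≤ ‖T (T (x - y))‖ * ‖x - y‖ := by
    have h4 := hT.isSymmetric (T (x - y)) (x - y)
    have h5 := norm_inner_le_norm (𝕜 := ℂ) (T (T (x - y))) (x - y)
    have h6 : ‖inner ℂ (T (x - y)) (T (x - y))‖ = ‖T (x - y)‖ ^ 2 := by
      rw [inner_self_eq_norm_sq_to_K]; simp
    rw [← h6]
    exact h4 ▸ h5
  have h7 : ‖T (x - y)‖ < ε := by
    refine lt_of_pow_lt_pow_left₀ 2 hε.le ?_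
    nlinarith [norm_nonneg (x - y), norm_nonneg (T (T (x - y)))]
  simpa [Metric.mem_ball, dist_eq_norm] using h7

/-- A compact self-adjoint operator has a total orthonormal family of eigenvectors. -/
theorem IsCompactOperator.exists_orthonormal_eigenvectors {C : H →L[ℂ] H}
    (hC : IsSelfAdjoint C) (hc : IsCompactOperator C) :
    ∃ (ι : Type u) (f : ι → H) (μ : ι → ℝ), Orthonormal ℂ f ∧ (∀ i, C (f i) = (μ i : ℂ) • f i) ∧
      ∀ x, (∀ i, inner ℂ (f i) x = 0) → x = 0 := by
  have hsymm : (C : H →ₗ[ℂ] H).IsSymmetric := hC.isSymmetric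
  -- The kernel of `C` may be infinite-dimensional, so every eigenspace gets a Hilbert basis, for
  -- which it must be complete.
  have hcl (z : ℂ) : IsClosed (Module.End.eigenspace (C : H →ₗ[ℂ] H) z : Set H) := by
    have : (Module.End.eigenspace (C : H →ₗ[ℂ] H) z : Set H) = {x | C x = z • x} := by
      ext x; simp
    rw [this]
    exact isClosed_eq (by fun_prop) (by fun_prop)
  have (z : ℂ) : CompleteSpace (Module.End.eigenspace (C : H →ₗ[ℂ] H) z) :=
    (hcl z).completeSpace_coe
  choose w b hb using fun z : ℂ =>
    exists_hilbertBasis ℂ (Module.End.eigenspace (C : H →ₗ[ℂ] H) z)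
  have hon := hsymm.orthogonalFamily_eigenspaces.orthonormal_sigma_orthonormal
    (fun z => (b z).orthonormal)
  have heig (i : Σ z, w z) : C (b i.1 i.2 : H) = i.1 • (b i.1 i.2 : H) :=
    Module.End.mem_eigenspace_iff.1 (b i.1 i.2).2
  refine ⟨Σ z, w z, fun i => (b i.1 i.2 : H), fun i => i.1.re, hon, fun i => ?_, fun x hx => ?_⟩
  · have hne : (b i.1 i.2 : H) ≠ 0 := hon.ne_zero i
    have := hsymm.conj_eigenvalue_eq_self (Module.End.hasEigenvalue_of_hasEigenvector
      ⟨Module.End.mem_eigenspace_iff.2 (heig i), hne⟩)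
    rw [Complex.conj_eq_iff_re.1 this]
    exact heig i
  · have hbot := ContinuousLinearMap.orthogonalComplement_iSup_eigenspaces_eq_bot hc hsymm
    rw [← Submodule.mem_bot ℂ, ← hbot, Submodule.mem_orthogonal]
    intro u hu
    refine Submodule.iSup_induction _ (motive := fun u => inner ℂ u x = 0) hu (fun z v hv => ?_)
      (by simp) (fun y z hy hz => by rw [inner_add_left, hy, hz, add_zero])
    have hv' := (b z).hasSum_repr ⟨v, hv⟩
    have h2 := (hv'.mapL (Submodule.subtypeL _)).mapL (innerSL ℂ x)
    have h3 : inner ℂ x v = 0 := by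
      refine h2.unique ?_
      convert hasSum_zero using 2 with j
      have := hx ⟨z, j⟩
      simp [inner_eq_zero_symm.1 this]
    exact inner_eq_zero_symm.1 h3

theorem ContinuousLinearMap.IsPositive.exists_isSelfAdjoint_comp_self {B : H →L[ℂ] H}
    (hB : B.IsPositive) : ∃ T : H →L[ℂ] H, IsSelfAdjoint T ∧ T ∘L T = B :=
  ⟨CFC.sqrt B, (CFC.sqrt_nonneg B).isSelfAdjoint,
    CFC.sqrt_mul_sqrt_self B ((ContinuousLinearMap.nonneg_iff_isPositive B).2 hB)⟩

/-- With `T` the square root of `B`, `⟨B x, x⟩ = ‖T x‖²`. This upgrades positivity to strict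
positivity when `B` is injective. -/
theorem ContinuousLinearMap.IsPositive.apply_eq_zero {B : H →L[ℂ] H} (hB : B.IsPositive) {x : H}
    (hx : inner ℂ (B x) x = 0) : B x = 0 := by
  obtain ⟨T, hT, rfl⟩ := hB.exists_isSelfAdjoint_comp_self
  have h : inner ℂ (T x) (T x) = 0 := by
    rw [← hx]
    exact (hT.isSymmetric (T x) x).symm
  rw [ContinuousLinearMap.comp_apply, inner_self_eq_zero.1 h, map_zero]

/-- For a symmetry `J` and an injective positive compact operator `B`, the product `J B` has a
total family of eigenvectors that is orthonormal for the form `⟨x, J y⟩`. -/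
theorem exists_form_orthonormal_eigenvectors {J B : H →L[ℂ] H} (hJ : IsSelfAdjoint J)
    (hJJ : ∀ x, J (J x) = x) (hB : B.IsPositive) (hc : IsCompactOperator B)
    (hinj : ∀ x, B x = 0 → x = 0) :
    ∃ (ι : Type u) (g : ι → H) (μ : ι → ℝ), (∀ i, μ i ≠ 0) ∧
      (∀ i, J (B (g i)) = (μ i : ℂ) • g i) ∧
      (∀ i, inner ℂ (g i) (J (g i)) = if μ i < 0 then -1 else 1) ∧
      (∀ i j, i ≠ j → inner ℂ (g i) (J (g j)) = 0) ∧
      ∀ x, (∀ i, inner ℂ (g i) x = 0) → x = 0 := by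
  obtain ⟨T, hTs, hTT⟩ := hB.exists_isSelfAdjoint_comp_self
  have hTT' (x : H) : T (T x) = B x := by rw [← hTT]; rfl
  have hTinj (x : H) (hx : T x = 0) : x = 0 := hinj x (by rw [← hTT', hx, map_zero])
  have hJinj (x : H) (hx : J x = 0) : x = 0 := by rw [← hJJ x, hx, map_zero]
  have hTc : IsCompactOperator T := .of_isSelfAdjoint_comp_self hTs (hTT ▸ hc)
  have hTsymm (x y : H) : inner ℂ (T x) y = inner ℂ x (T y) := hTs.isSymmetric x y
  have hJsymm (x y : H) : inner ℂ (J x) y = inner ℂ x (J y) := hJ.isSymmetric x y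
  have hCs : IsSelfAdjoint (T ∘L J ∘L T) := by
    rw [ContinuousLinearMap.isSelfAdjoint_iff_isSymmetric]
    intro x y
    change inner ℂ (T (J (T x))) y = inner ℂ x (T (J (T y)))
    rw [hTsymm, hJsymm, hTsymm]
  obtain ⟨ι, f, μ, hf, heig, htot⟩ :=
    IsCompactOperator.exists_orthonormal_eigenvectors hCs (hTc.comp_clm (J ∘L T))
  have heig' (i : ι) : T (J (T (f i))) = (μ i : ℂ) • f i := heig i
  have hμ (i : ι) : μ i ≠ 0 := by
    intro h
    have h1 := heig' i
    rw [h, Complex.ofReal_zero, zero_smul] at h1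
    exact hf.ne_zero i (hTinj _ (hJinj _ (hTinj _ h1)))
  -- The form pulled back along `J T` is `⟨x, T J T y⟩`, which the eigenvectors `f i` diagonalize;
  -- this dictates the scaling by `|μ i|^(-1/2)` below.
  have hform (i j : ι) : inner ℂ (J (T (f i))) (J (J (T (f j)))) =
      (μ j : ℂ) * inner ℂ (f i) (f j) := by
    rw [hJJ, hJsymm, hTsymm, heig', inner_smul_right]
  refine ⟨ι, fun i => ((√|μ i| : ℝ) : ℂ)⁻¹ • J (T (f i)), μ, hμ, fun i => ?_, fun i => ?_,
    fun i j hij => ?_, fun x hx => ?_⟩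
  · rw [map_smul, map_smul, ← hTT', heig', map_smul, map_smul, smul_comm]
  · rw [map_smul, inner_smul_left, inner_smul_right, hform, inner_self_eq_norm_sq_to_K, hf.1 i]
    have h1 : ((√|μ i| : ℝ) : ℂ)⁻¹ * ((√|μ i| : ℝ) : ℂ)⁻¹ = ((|μ i| : ℝ) : ℂ)⁻¹ := by
      rw [← mul_inv, ← Complex.ofReal_mul, Real.mul_self_sqrt (abs_nonneg _)]
    have h2 : (μ i : ℂ) ≠ 0 := Complex.ofReal_ne_zero.2 (hμ i)
    simp only [map_inv₀, Complex.conj_ofReal, RCLike.ofReal_one, one_pow,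
      mul_one, ← mul_assoc, h1]
    split_ifs with h
    · rw [abs_of_neg h, Complex.ofReal_neg, inv_neg, neg_mul, inv_mul_cancel₀ h2]
    · rw [abs_of_nonneg (not_lt.1 h), inv_mul_cancel₀ h2]
  · rw [map_smul, inner_smul_left, inner_smul_right, hform, hf.2 hij]
    simp
  -- Up to a nonzero factor, `⟨g i, x⟩` is `⟨f i, T (J x)⟩`, so totality passes from `f` to `g` by
  -- injectivity of `T` and `J`.
  · refine hJinj x (hTinj _ (htot _ fun i => ?_))
    have h1 := hx i
    simp only [inner_smul_left, mul_eq_zero] at h1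
    rw [← hTsymm, ← hJsymm]
    exact h1.resolve_left (by
      simpa using (Real.sqrt_ne_zero (abs_nonneg _)).2 (abs_ne_zero.2 (hμ i)))

end HilbertSpace

/-! ### Expansions in families orthonormal for an indefinite form -/

section FormExpansion

universe u v

variable {H : Type u} [NormedAddCommGroup H] [InnerProductSpace ℂ H]

/-- A family that is orthonormal (with signs `ε`) for the form `⟨x, J y⟩`, contains only finitely
many negative vectors, and is total. -/
structure IsTotalFormOrthonormal (J : H →L[ℂ] H) {ι : Type v} (g : ι → H) (ε : ι → ℝ) : Prop where
  symm : ∀ x y, inner ℂ (J x) y = inner ℂ x (J y)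
  involutive : ∀ x, J (J x) = x
  sign : ∀ i, ε i = 1 ∨ ε i = -1
  self : ∀ i, inner ℂ (g i) (J (g i)) = (ε i : ℂ)
  orthogonal : ∀ i j, i ≠ j → inner ℂ (g i) (J (g j)) = 0
  finite_neg : {i | ε i = -1}.Finite
  total : ∀ x, (∀ i, inner ℂ (g i) x = 0) → x = 0

/-- The partial sum over `F` of the expansion in a form-orthonormal family. -/
noncomputable def formPartialSum (J : H →L[ℂ] H) {ι : Type v} (g : ι → H) (ε : ι → ℝ)
    (F : Finset ι) : H →L[ℂ] H :=
  ∑ i ∈ F, (ε i : ℂ) • (rankOne ℂ (g i) (g i) ∘L J)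

theorem formPartialSum_apply (J : H →L[ℂ] H) {ι : Type v} (g : ι → H) (ε : ι → ℝ)
    (F : Finset ι) (x : H) :
    formPartialSum J g ε F x = ∑ i ∈ F, ((ε i : ℂ) * inner ℂ (g i) (J x)) • g i := by
  simp [formPartialSum, mul_smul]

namespace IsTotalFormOrthonormal

variable {J : H →L[ℂ] H} {ι : Type v} {g : ι → H} {ε : ι → ℝ}
  (h : IsTotalFormOrthonormal J g ε)

include h

theorem sign_mul_sign (i : ι) : (ε i : ℂ) * ε i = 1 := by
  rcases h.sign i with h | h <;> simp [h]

theorem inner_formPartialSum (F : Finset ι) (x : H) (i : ι) [DecidableEq ι] :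
    inner ℂ (g i) (J (formPartialSum J g ε F x)) = if i ∈ F then inner ℂ (g i) (J x) else 0 := by
  rw [formPartialSum_apply, map_sum, inner_sum]
  have : ∀ j ∈ F, inner ℂ (g i) (J (((ε j : ℂ) * inner ℂ (g j) (J x)) • g j)) =
      if i = j then inner ℂ (g i) (J x) else 0 := by
    intro j _
    rw [map_smul, inner_smul_right]
    split_ifs with hij
    · subst hij
      rw [h.self, mul_right_comm, h.sign_mul_sign, one_mul]
    · rw [h.orthogonal i j hij, mul_zero]
  rw [Finset.sum_congr rfl this, Finset.sum_ite_eq]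

omit h in
theorem inner_formPartialSum_left (F : Finset ι) (x y : H) :
    inner ℂ (formPartialSum J g ε F x) (J y) =
      ∑ i ∈ F, (ε i : ℂ) * (conj (inner ℂ (g i) (J x)) * inner ℂ (g i) (J y)) := by
  rw [formPartialSum_apply, sum_inner]
  refine Finset.sum_congr rfl fun i _ => ?_
  rw [inner_smul_left, map_mul, Complex.conj_ofReal, mul_assoc]

/-- Pythagoras for the form-orthogonal projection onto the span of the members in `F`. No inequality
follows yet, as the form of the remainder may be negative. -/
theorem re_form_sub_formPartialSum (F : Finset ι) (x : H) :
    (inner ℂ (x - formPartialSum J g ε F x) (J (x - formPartialSum J g ε F x))).re =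
      (inner ℂ x (J x)).re - ∑ i ∈ F, ε i * ‖inner ℂ (g i) (J x)‖ ^ 2 := by
  classical
  have h1 (y : H) (hy : ∀ i ∈ F, inner ℂ (g i) (J y) = inner ℂ (g i) (J x)) :
      inner ℂ (formPartialSum J g ε F x) (J y) =
        ((∑ i ∈ F, ε i * ‖inner ℂ (g i) (J x)‖ ^ 2 : ℝ) : ℂ) := by
    rw [inner_formPartialSum_left, Complex.ofReal_sum]
    refine Finset.sum_congr rfl fun i hi => ?_
    rw [hy i hi, Complex.conj_mul', Complex.ofReal_mul, Complex.ofReal_pow]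
  have h2 := h1 x fun _ _ => rfl
  have h3 := h1 (formPartialSum J g ε F x) fun i hi => by rw [h.inner_formPartialSum, if_pos hi]
  have h4 : inner ℂ x (J (formPartialSum J g ε F x)) =
      ((∑ i ∈ F, ε i * ‖inner ℂ (g i) (J x)‖ ^ 2 : ℝ) : ℂ) := by
    rw [← h.symm, ← inner_conj_symm, h2, Complex.conj_ofReal]
  rw [map_sub, inner_sub_left, inner_sub_right, inner_sub_right, h2, h3, h4,
    sub_self, sub_zero, Complex.sub_re, Complex.ofReal_re]

theorem exists_formPartialSum_eq {x : H} (hx : x ∈ Submodule.span ℂ (Set.range g)) :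
    ∃ F₀ : Finset ι, ∀ F, F₀ ⊆ F → formPartialSum J g ε F x = x := by
  classical
  induction hx using Submodule.span_induction with
  | mem x hx =>
    obtain ⟨i, rfl⟩ := hx
    refine ⟨{i}, fun F hF => ?_⟩
    rw [formPartialSum_apply, Finset.sum_eq_single_of_mem i (hF (Finset.mem_singleton_self i)),
      h.self, h.sign_mul_sign, one_smul]
    intro j _ hj
    rw [h.orthogonal j i hj, mul_zero, zero_smul]
  | zero => exact ⟨∅, fun F _ => map_zero _⟩
  | add x y _ _ hx hy =>
    obtain ⟨F₁, h₁⟩ := hx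
    obtain ⟨F₂, h₂⟩ := hy
    exact ⟨F₁ ∪ F₂, fun F hF => by
      rw [map_add, h₁ F (Finset.union_subset_left hF), h₂ F (Finset.union_subset_right hF)]⟩
  | smul a x _ hx =>
    obtain ⟨F₁, h₁⟩ := hx
    exact ⟨F₁, fun F hF => by rw [map_smul, h₁ F hF]⟩

/-- A vector of the span is a finite combination, so removing its terms in `N` leaves only positive
members, and the form of the remainder is a sum of squares. -/
theorem inner_self_formPartialSum_nonneg_of_mem_span {N : Finset ι} (hN : ∀ i ∉ N, ε i = 1)
    {x : H} (hx : x ∈ Submodule.span ℂ (Set.range g)) :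
    0 ≤ (inner ℂ (x - formPartialSum J g ε N x) (J (x - formPartialSum J g ε N x))).re := by
  classical
  obtain ⟨F₀, hF₀⟩ := h.exists_formPartialSum_eq hx
  have h1 := h.re_form_sub_formPartialSum (F₀ ∪ N) x
  rw [hF₀ _ Finset.subset_union_left, sub_self, map_zero, inner_zero_left, Complex.zero_re] at h1
  rw [h.re_form_sub_formPartialSum, ← sub_add_cancel (inner ℂ x (J x)).re
    (∑ i ∈ F₀ ∪ N, ε i * ‖inner ℂ (g i) (J x)‖ ^ 2), ← h1, zero_add,
    ← Finset.sum_sdiff (Finset.subset_union_right (s₁ := F₀)), add_sub_cancel_right]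
  refine Finset.sum_nonneg fun i hi => ?_
  rw [hN i (Finset.mem_sdiff.1 hi).2, one_mul]
  positivity

variable [CompleteSpace H]

theorem topologicalClosure_span : (Submodule.span ℂ (Set.range g)).topologicalClosure = ⊤ := by
  rw [Submodule.topologicalClosure_eq_top_iff, Submodule.eq_bot_iff]
  intro x hx
  exact h.total x fun i => hx (g i) (Submodule.subset_span ⟨i, rfl⟩)

theorem dense_span : Dense (Submodule.span ℂ (Set.range g) : Set H) :=
  (Submodule.dense_iff_topologicalClosure_eq_top).2 h.topologicalClosure_span

/-- The form is nonnegative on vectors orthogonal to the negative members of the family. -/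
theorem re_form_nonneg {y : H} (hy : ∀ i, ε i = -1 → inner ℂ (g i) (J y) = 0) :
    0 ≤ (inner ℂ y (J y)).re := by
  have hN : ∀ i ∉ h.finite_neg.toFinset, ε i = 1 := fun i hi =>
    (h.sign i).resolve_right fun h' => hi (by simpa using h')
  -- Vectors of the span approximating `y` need not be orthogonal to the negative members.
  -- Subtracting the negative partial sum makes them so, depends continuously on `x`, and changes
  -- nothing at `x = y`.
  have hall : ∀ x : H, 0 ≤ (inner ℂ (x - formPartialSum J g ε h.finite_neg.toFinset x)
      (J (x - formPartialSum J g ε h.finite_neg.toFinset x))).re := by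
    intro x
    refine h.dense_span.induction (P := fun x => 0 ≤ (inner ℂ
      (x - formPartialSum J g ε h.finite_neg.toFinset x)
      (J (x - formPartialSum J g ε h.finite_neg.toFinset x))).re)
      (fun x hx => h.inner_self_formPartialSum_nonneg_of_mem_span hN hx) ?_ x
    exact isClosed_le continuous_const (Complex.continuous_re.comp (by fun_prop))
  have h0 : formPartialSum J g ε h.finite_neg.toFinset y = 0 := by
    rw [formPartialSum_apply]
    refine Finset.sum_eq_zero fun i hi => ?_
    rw [hy i (by simpa using hi), mul_zero, zero_smul]
  simpa [h0] using hall y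

/-- Bessel's inequality: once `F` is enlarged by the negative indices `N`, the remainder has
nonnegative form. Turning the finitely many minus signs into plus signs costs twice the sum over
`N`. -/
theorem exists_sum_norm_sq_le (x : H) :
    ∃ M : ℝ, ∀ F : Finset ι, ∑ i ∈ F, ‖inner ℂ (g i) (J x)‖ ^ 2 ≤ M := by
  classical
  set N := h.finite_neg.toFinset with hNdef
  refine ⟨(inner ℂ x (J x)).re + 2 * ∑ i ∈ N, ‖inner ℂ (g i) (J x)‖ ^ 2, fun F => ?_⟩
  have h1 : 0 ≤ (inner ℂ x (J x)).re - ∑ i ∈ F ∪ N, ε i * ‖inner ℂ (g i) (J x)‖ ^ 2 := by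
    rw [← h.re_form_sub_formPartialSum]
    refine h.re_form_nonneg fun i hi => ?_
    rw [map_sub, inner_sub_right, h.inner_formPartialSum, if_pos, sub_self]
    simp [hNdef, hi]
  have h2 : ∑ i ∈ F, ‖inner ℂ (g i) (J x)‖ ^ 2 ≤ ∑ i ∈ F ∪ N, ‖inner ℂ (g i) (J x)‖ ^ 2 :=
    Finset.sum_le_sum_of_subset_of_nonneg Finset.subset_union_left fun _ _ _ => by positivity
  have h3 : ∑ i ∈ F ∪ N, ε i * ‖inner ℂ (g i) (J x)‖ ^ 2 =
      ∑ i ∈ F ∪ N, ‖inner ℂ (g i) (J x)‖ ^ 2 - 2 * ∑ i ∈ N, ‖inner ℂ (g i) (J x)‖ ^ 2 := by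
    rw [← Finset.sum_sdiff (Finset.subset_union_right (s₁ := F)),
      ← Finset.sum_sdiff (Finset.subset_union_right (s₁ := F))
        (f := fun i => ‖inner ℂ (g i) (J x)‖ ^ 2)]
    have h4 : ∑ i ∈ (F ∪ N) \ N, ε i * ‖inner ℂ (g i) (J x)‖ ^ 2 =
        ∑ i ∈ (F ∪ N) \ N, ‖inner ℂ (g i) (J x)‖ ^ 2 := by
      refine Finset.sum_congr rfl fun i hi => ?_
      rw [(h.sign i).resolve_right fun h' => (Finset.mem_sdiff.1 hi).2 (by simp [hNdef, h']),
        one_mul]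
    have h5 : ∑ i ∈ N, ε i * ‖inner ℂ (g i) (J x)‖ ^ 2 =
        - ∑ i ∈ N, ‖inner ℂ (g i) (J x)‖ ^ 2 := by
      rw [← Finset.sum_neg_distrib]
      refine Finset.sum_congr rfl fun i hi => ?_
      rw [show ε i = -1 by simpa [hNdef] using hi, neg_one_mul]
    rw [h4, h5]; ring
  linarith

/-- Uniform boundedness is applied twice, to the operators and to the functionals given by their
values at `x`. This leaves the numbers `⟨S_F x, y⟩`, bounded by the Bessel sums of `x` and of `J y`.
-/
theorem exists_norm_formPartialSum_le :
    ∃ M : ℝ, ∀ F : Finset ι, ‖formPartialSum J g ε F‖ ≤ M := by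
  refine banach_steinhaus fun x => ?_
  suffices ∃ M, ∀ F : Finset ι, ‖innerSL ℂ (formPartialSum J g ε F x)‖ ≤ M by
    simpa only [innerSL_apply_norm] using this
  refine banach_steinhaus fun y => ?_
  obtain ⟨M₁, h₁⟩ := h.exists_sum_norm_sq_le x
  obtain ⟨M₂, h₂⟩ := h.exists_sum_norm_sq_le (J y)
  refine ⟨(M₁ + M₂) / 2, fun F => ?_⟩
  rw [innerSL_apply_apply, ← h.involutive y, inner_formPartialSum_left]
  calc _ ≤ ∑ i ∈ F, (‖inner ℂ (g i) (J x)‖ ^ 2 + ‖inner ℂ (g i) (J (J y))‖ ^ 2) / 2 := by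
        refine (norm_sum_le _ _).trans (Finset.sum_le_sum fun i _ => ?_)
        have : ‖(ε i : ℂ)‖ = 1 := by rcases h.sign i with h | h <;> simp [h]
        rw [norm_mul, norm_mul, this, RCLike.norm_conj, one_mul]
        linarith [two_mul_le_add_sq ‖inner ℂ (g i) (J x)‖ ‖inner ℂ (g i) (J (J y))‖]
    _ ≤ _ := by
        rw [← Finset.sum_div, Finset.sum_add_distrib]
        linarith [h₁ F, h₂ F]

/-- Every vector is the unconditional sum of its expansion. -/
theorem hasSum_expansion (x : H) :
    HasSum (fun i => ((ε i : ℂ) * inner ℂ (g i) (J x)) • g i) x := by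
  classical
  obtain ⟨M, hM⟩ := h.exists_norm_formPartialSum_le
  have hM0 : 0 ≤ M := (norm_nonneg _).trans (hM ∅)
  rw [HasSum, SummationFilter.unconditional_filter, Metric.tendsto_atTop]
  intro δ hδ
  -- Large partial sums fix `z`, so the error is at most `(M + 1) ‖x - z‖`, which is less than `δ`.
  obtain ⟨z, hz, hxz⟩ := Metric.mem_closure_iff.1 (h.dense_span x) (δ / (M + 2)) (by positivity)
  obtain ⟨F₀, hF₀⟩ := h.exists_formPartialSum_eq hz
  refine ⟨F₀, fun F hF => ?_⟩
  rw [← formPartialSum_apply, dist_eq_norm]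
  have h1 : formPartialSum J g ε F x - x = formPartialSum J g ε F (x - z) - (x - z) := by
    rw [map_sub, hF₀ F hF]; abel
  rw [dist_eq_norm, lt_div_iff₀ (by positivity)] at hxz
  have h2 := (formPartialSum J g ε F).le_of_opNorm_le (hM F) (x - z)
  rw [h1]
  have h3 := norm_sub_le (formPartialSum J g ε F (x - z)) (x - z)
  nlinarith [norm_nonneg (x - z)]

omit [CompleteSpace H] in
theorem eq_of_hasSum {c : ι → ℂ} {x : H} (hc : HasSum (fun i => c i • g i) x) (i : ι) :
    c i = (ε i : ℂ) * inner ℂ (g i) (J x) := by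
  have h1 := (hc.mapL J).mapL (innerSL ℂ (g i))
  have h2 := h1.unique (hasSum_single i fun j hj => by
    simp [h.orthogonal i j hj.symm])
  simp only [innerSL_apply_apply, map_smul, h.self, smul_eq_mul] at h2
  rw [h2, mul_left_comm, h.sign_mul_sign, mul_one]

end IsTotalFormOrthonormal

end FormExpansion

/-! ### Counting negative vectors, and polarization -/

namespace PontryaginSpace

section Algebraic

universe u v

variable {κ : ℕ} {E : Type u} [AddCommGroup E] [Module ℂ E] (P : PontryaginSpace κ E)

theorem posPart_add_negPart (x : E) : P.posPart x + P.negPart x = x :=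
  Submodule.projection_add_projection_eq_self P.isCompl x

theorem posPart_of_mem_pos {x : E} (hx : x ∈ P.pos) : P.posPart x = x := by
  have := P.posPart_add_negPart x
  rwa [P.negPart_eq_zero.2 hx, add_zero] at this

theorem negPart_of_mem_neg {x : E} (hx : x ∈ P.neg) : P.negPart x = x := by
  have := P.posPart_add_negPart x
  rwa [P.posPart_eq_zero.2 hx, zero_add] at this

theorem form_eq (x y : E) : P.form x y =
    P.form (P.posPart x) (P.posPart y) + P.form (P.negPart x) (P.negPart y) := by
  conv_lhs => rw [← P.posPart_add_negPart x, ← P.posPart_add_negPart y]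
  have h : P.form (P.negPart x) (P.posPart y) = 0 := by
    rw [← P.conj_symm, P.orthogonal _ (P.posPart_mem y) _ (P.negPart_mem x), map_zero]
  simp only [map_add, LinearMap.add_apply]
  rw [h, P.orthogonal _ (P.posPart_mem x) _ (P.negPart_mem y)]
  ring

/-- A form-orthonormal family of negative vectors has linearly independent components in `neg`. -/
theorem linearIndependent_negPart {ι : Type v} {g : ι → E}
    (hself : ∀ i, P.form (g i) (g i) = -1) (horth : ∀ i j, i ≠ j → P.form (g i) (g j) = 0) :
    LinearIndependent ℂ (fun i => (⟨P.negPart (g i), P.negPart_mem _⟩ : P.neg)) := by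
  classical
  rw [linearIndependent_iff']
  intro s c hc i hi
  -- A linear relation among the negative components puts `x` in `pos`, where the form is
  -- nonnegative, whereas `[x, x] = -∑ |c j|²`.
  set x := ∑ i ∈ s, c i • g i with hx
  have hxpos : x ∈ P.pos := by
    rw [← P.negPart_eq_zero, hx, map_sum]
    simpa using congrArg Subtype.val hc
  have hcoef : ∀ j ∈ s, P.form x (g j) = -conj (c j) := by
    intro j hj
    rw [hx, map_sum, LinearMap.sum_apply, Finset.sum_eq_single_of_mem j hj]
    · simp [hself]
    · intro k _ hk
      simp [horth k j hk]
  have hform : P.form x x = -((∑ j ∈ s, ‖c j‖ ^ 2 : ℝ) : ℂ) := by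
    conv_lhs => rw [hx, map_sum, ← hx]
    rw [Complex.ofReal_sum, ← Finset.sum_neg_distrib]
    refine Finset.sum_congr rfl fun j hj => ?_
    rw [map_smul, hcoef j hj, smul_eq_mul, mul_neg, Complex.mul_conj', Complex.ofReal_pow]
  have h1 := P.re_form_nonneg hxpos
  rw [hform, ← Complex.ofReal_neg, Complex.ofReal_re] at h1
  have h2 : ∑ j ∈ s, ‖c j‖ ^ 2 = 0 :=
    le_antisymm (by linarith) (Finset.sum_nonneg fun _ _ => by positivity)
  have h3 := (Finset.sum_eq_zero_iff_of_nonneg fun _ _ => by positivity).1 h2 i hi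
  simpa using h3

theorem finite_of_form_neg {ι : Type v} {g : ι → E}
    (hself : ∀ i, P.form (g i) (g i) = -1) (horth : ∀ i j, i ≠ j → P.form (g i) (g j) = 0) :
    Finite ι ∧ Nat.card ι ≤ κ := by
  have := P.finiteDimensional_neg
  have hli := P.linearIndependent_negPart hself horth
  have := hli.finite
  refine ⟨this, ?_⟩
  have := Fintype.ofFinite ι
  rw [Nat.card_eq_fintype_card, ← P.finrank_neg]
  exact hli.fintype_card_le_finrank

/-- A nonzero vector of `neg` cannot be form-orthogonal to every `g i`, so `y ↦ ([g i, y])ᵢ` embeds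
`neg` into `ℂ^ι`. -/
theorem index_le_card {ι : Type v} [Finite ι] {g : ι → E}
    (hnonneg : ∀ y, (∀ i, P.form (g i) y = 0) → 0 ≤ (P.form y y).re) : κ ≤ Nat.card ι := by
  have := Fintype.ofFinite ι
  let f : P.neg →ₗ[ℂ] (ι → ℂ) := LinearMap.pi fun i => P.form (g i) ∘ₗ P.neg.subtype
  have hf : Function.Injective f := by
    rw [injective_iff_map_eq_zero]
    intro y hy
    by_contra hne
    have h1 := P.neg_def y y.2 fun h => hne (Subtype.ext h)
    have h2 := hnonneg y fun i => congrFun hy i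
    linarith
  have h3 := LinearMap.finrank_le_finrank_of_injective hf
  rwa [P.finrank_neg, Module.finrank_fintype_fun_eq_card, ← Nat.card_eq_fintype_card] at h3

/-- Polarization: reality of `[A z, z]` at `z = x + y` and at `z = x + i y` suffices, the form being
complex. -/
theorem form_map_of_isPositiveOp {A : E →ₗ[ℂ] E} (hA : P.IsPositiveOp A) (x y : E) :
    P.form (A x) y = P.form x (A y) := by
  have hs (z : E) : P.form z (A z) = P.form (A z) z := by
    rw [← P.conj_symm, Complex.conj_eq_iff_im.2 (hA z).1]
  have h1 := hs (x + y)
  have h2 := hs (x + Complex.I • y)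
  simp only [map_add, LinearMap.add_apply, map_smul, LinearMap.map_smulₛₗ, LinearMap.smul_apply,
    smul_eq_mul, Complex.conj_I, hs x, hs y] at h1 h2
  linear_combination (-1 / 2 : ℂ) * h1 + (Complex.I / 2 : ℂ) * h2 + (1 / 2 : ℂ) *
    (P.form (A x) y - P.form x (A y) + P.form y (A x) - P.form (A y) x) * Complex.I_sq

end Algebraic

/-! ### The Hilbert space structure and the eigenbasis -/

section Topological

universe u

variable {κ : ℕ} {E : Type u} [NormedAddCommGroup E] [InnerProductSpace ℂ E]
  (P : PontryaginSpace κ E)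

/-- The norm of `E` is the Hilbert norm of the Pontryagin space. -/
def IsHilbertInner : Prop :=
  ∀ x y : E, inner ℂ x y =
    P.form (P.posPart x) (P.posPart y) - P.form (P.negPart x) (P.negPart y)

variable {P} (hP : P.IsHilbertInner)

include hP

theorem IsHilbertInner.norm_sq (x : E) : ‖x‖ ^ 2 =
    (P.form (P.posPart x) (P.posPart x)).re - (P.form (P.negPart x) (P.negPart x)).re := by
  rw [← inner_self_eq_norm_sq (𝕜 := ℂ), hP]
  rfl

theorem IsHilbertInner.norm_of_mem_pos {x : E} (hx : x ∈ P.pos) :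
    ‖x‖ = √(P.form x x).re := by
  rw [eq_comm, Real.sqrt_eq_iff_mul_self_eq (P.re_form_nonneg hx) (norm_nonneg x), ← sq,
    hP.norm_sq, P.posPart_of_mem_pos hx, P.negPart_eq_zero.2 hx]
  simp

theorem IsHilbertInner.norm_posPart_le (x : E) : ‖P.posPart x‖ ≤ ‖x‖ := by
  refine le_of_sq_le_sq ?_ (norm_nonneg x)
  have h1 := P.posPart_mem x
  rw [hP.norm_sq, hP.norm_sq, P.posPart_of_mem_pos h1, P.negPart_eq_zero.2 h1]
  simpa using P.re_form_nonpos (P.negPart_mem x)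

theorem IsHilbertInner.norm_negPart_le (x : E) : ‖P.negPart x‖ ≤ ‖x‖ := by
  refine le_of_sq_le_sq ?_ (norm_nonneg x)
  have h1 := P.negPart_mem x
  rw [hP.norm_sq, hP.norm_sq, P.negPart_of_mem_neg h1, P.posPart_eq_zero.2 h1]
  simpa using P.re_form_nonneg (P.posPart_mem x)

/-- Both projections are contractions, so a Cauchy sequence splits into Cauchy components; `pos` is
complete by hypothesis and `neg` because it is finite-dimensional. -/
theorem IsHilbertInner.completeSpace : CompleteSpace E := by
  have := P.finiteDimensional_neg
  refine Metric.complete_of_cauchySeq_tendsto fun u hu => ?_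
  obtain ⟨p, hp, hup⟩ : ∃ p ∈ P.pos, Tendsto (fun n => P.posPart (u n)) atTop (𝓝 p) := by
    obtain ⟨p, hp, hup⟩ := P.complete_pos (fun n => P.posPart (u n))
      (fun n => P.posPart_mem _) fun δ hδ => by
        obtain ⟨k, hk⟩ := Metric.cauchySeq_iff.1 hu δ hδ
        refine ⟨k, fun m hm n hn => ?_⟩
        rw [← map_sub, ← hP.norm_of_mem_pos (P.posPart_mem _)]
        exact (hP.norm_posPart_le _).trans_lt (by simpa [dist_eq_norm] using hk m hm n hn)
    refine ⟨p, hp, Metric.tendsto_atTop.2 fun δ hδ => ?_⟩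
    obtain ⟨k, hk⟩ := hup δ hδ
    refine ⟨k, fun n hn => ?_⟩
    rw [dist_eq_norm, hP.norm_of_mem_pos (P.pos.sub_mem (P.posPart_mem _) hp)]
    exact hk n hn
  obtain ⟨q, hq⟩ : ∃ q : P.neg, Tendsto (fun n => (⟨P.negPart (u n), P.negPart_mem _⟩ : P.neg))
      atTop (𝓝 q) := by
    have := FiniteDimensional.complete ℂ P.neg
    refine cauchySeq_tendsto_of_complete (Metric.cauchySeq_iff.2 fun δ hδ => ?_)
    obtain ⟨k, hk⟩ := Metric.cauchySeq_iff.1 hu δ hδ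
    refine ⟨k, fun m hm n hn => ?_⟩
    rw [Subtype.dist_eq, dist_eq_norm, ← map_sub]
    exact (hP.norm_negPart_le _).trans_lt (by simpa [dist_eq_norm] using hk m hm n hn)
  refine ⟨p + q, ?_⟩
  simpa [P.posPart_add_negPart] using hup.add ((continuous_subtype_val.tendsto q).comp hq)

/-- The fundamental symmetry `x ↦ x₊ - x₋`. -/
theorem IsHilbertInner.exists_symmetry : ∃ J : E →L[ℂ] E,
    (∀ x y, P.form x y = inner ℂ x (J y)) ∧ (∀ x y, inner ℂ (J x) y = inner ℂ x (J y)) ∧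
      ∀ x, J (J x) = x := by
  have hpos (x : E) : P.posPart (P.posPart x - P.negPart x) = P.posPart x := by
    rw [map_sub, P.posPart_of_mem_pos (P.posPart_mem x), P.posPart_eq_zero.2 (P.negPart_mem x),
      sub_zero]
  have hneg (x : E) : P.negPart (P.posPart x - P.negPart x) = -P.negPart x := by
    rw [map_sub, P.negPart_of_mem_neg (P.negPart_mem x), P.negPart_eq_zero.2 (P.posPart_mem x),
      zero_sub]
  refine ⟨(P.posPart - P.negPart).mkContinuous 2 fun x => ?_, fun x y => ?_, fun x y => ?_,
    fun x => ?_⟩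
  · have := norm_sub_le (P.posPart x) (P.negPart x)
    have h1 := hP.norm_posPart_le x
    have h2 := hP.norm_negPart_le x
    rw [LinearMap.sub_apply]
    linarith
  · rw [hP, P.form_eq]
    simp [hpos, hneg]
  · rw [hP, hP]
    simp [hpos, hneg]
  · simp only [LinearMap.mkContinuous_apply, LinearMap.sub_apply, hpos, hneg]
    rw [sub_neg_eq_add, P.posPart_add_negPart]

/-- Injective positive compact operators on a Pontryagin space have a form-orthonormal basis of
eigenvectors, exactly `κ` of which are negative. -/
theorem IsHilbertInner.exists_eigenbasis {A : E →ₗ[ℂ] E} (hpos : P.IsPositiveOp A)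
    (hc : IsCompactOperator A) (hinj : ∀ x, A x = 0 → x = 0) :
    (∀ x, x ≠ 0 → 0 < (P.form (A x) x).re) ∧
    ∃ (ι : Type u) (g : ι → E) (μ : ι → ℝ), (∀ i, μ i ≠ 0) ∧ (∀ i, A (g i) = (μ i : ℂ) • g i) ∧
      (∀ i, P.form (g i) (g i) = if μ i < 0 then -1 else 1) ∧
      (∀ i j, i ≠ j → P.form (g i) (g j) = 0) ∧
      {i | μ i < 0}.encard = κ ∧
      (∀ (x : E) (c : ι → ℂ), HasSum (fun i => c i • g i) x ↔
        ∀ i, c i = (if μ i < 0 then -1 else 1) * P.form (g i) x) ∧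
      ∀ (x : E) (F : Finset ι), (∀ i ∉ F, P.form (g i) x = 0) →
        x = ∑ i ∈ F, ((if μ i < 0 then -1 else 1) * P.form (g i) x) • g i := by
  have := hP.completeSpace
  obtain ⟨J, hJform, hJsymm, hJJ⟩ := hP.exists_symmetry
  have hJs : IsSelfAdjoint J := ContinuousLinearMap.isSelfAdjoint_iff_isSymmetric.2 hJsymm
  let A' : E →L[ℂ] E := ⟨A, hc.continuous⟩
  have hBform (x : E) : inner ℂ ((J ∘L A') x) x = P.form (A x) x := by
    rw [hJform, ← hJsymm]; rfl
  have hB : (J ∘L A').IsPositive := by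
    rw [ContinuousLinearMap.isPositive_iff_complex]
    intro x
    rw [hBform]
    exact ⟨Complex.ext rfl (by simp [(hpos x).1]), (hpos x).2⟩
  have hBinj (x : E) (hx : (J ∘L A') x = 0) : x = 0 := by
    refine hinj x ?_
    rw [← hJJ (A x)]
    exact (congrArg J hx).trans (map_zero J)
  have hBc : IsCompactOperator (J ∘L A') := hc.clm_comp J
  obtain ⟨ι, g, μ, hμ, heig, hself, horth, htot⟩ :=
    exists_form_orthonormal_eigenvectors hJs hJJ hB hBc hBinj
  have heig' (i : ι) : A (g i) = (μ i : ℂ) • g i := by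
    rw [← heig i]; exact (hJJ _).symm
  simp only [← hJform] at hself horth
  -- Finiteness of the negative part must precede the expansion theory, which assumes it; equality
  -- with `κ` comes only afterwards.
  have hfin := P.finite_of_form_neg (ι := {i | μ i < 0}) (g := fun i => g i)
    (fun i => by rw [hself]; exact if_pos i.2) (fun i j hij => horth i j fun h => hij (Subtype.ext h))
  have hfinite : Finite {i | μ i < 0} := hfin.1
  have hbas : IsTotalFormOrthonormal J g (fun i => if μ i < 0 then -1 else 1) := by
    refine ⟨hJsymm, hJJ, fun i => ?_, fun i => ?_, fun i j hij => ?_, ?_, htot⟩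
    · by_cases h : μ i < 0 <;> simp [h]
    · rw [← hJform, hself]
      split_ifs <;> simp
    · rw [← hJform, horth i j hij]
    · refine (Set.toFinite {i | μ i < 0}).subset fun i hi => ?_
      by_contra h
      have h' : ¬ μ i < 0 := h
      norm_num [h'] at hi
  have hcast (i : ι) : (((if μ i < 0 then -1 else 1 : ℝ)) : ℂ) = if μ i < 0 then -1 else 1 := by
    split_ifs <;> simp
  have hsum (x : E) : HasSum (fun i => ((if μ i < 0 then -1 else 1) * P.form (g i) x) • g i) x := by
    simpa only [hcast, ← hJform] using hbas.hasSum_expansion x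
  refine ⟨fun x hx => ?_, ι, g, μ, hμ, heig', hself, horth, ?_, fun x c =>
    ⟨fun h i => ?_, fun h => ?_⟩, fun x F hF => ?_⟩
  -- If `[A x, x] = 0`, then `⟨B x, x⟩ = 0` for the positive operator `B = J A`, hence `B x = 0`.
  · refine (hpos x).2.lt_of_ne fun h0 => hx (hinj x ?_)
    have h1 : (J ∘L A') x = 0 :=
      hB.apply_eq_zero (by rw [hBform]; exact Complex.ext h0.symm (hpos x).1)
    rw [hBinj x h1, map_zero]
  · have h1 := P.index_le_card (ι := {i | μ i < 0}) (g := fun i => g i) fun y hy => by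
      rw [hJform]
      refine hbas.re_form_nonneg fun i hi => ?_
      rw [← hJform]
      refine hy ⟨i, ?_⟩
      by_contra h
      have h' : ¬ μ i < 0 := h
      norm_num [h'] at hi
    rw [← Set.Finite.cast_ncard_eq (Set.toFinite {i | μ i < 0}), ← Nat.card_coe_set_eq,
      le_antisymm hfin.2 h1]
  · rw [hbas.eq_of_hasSum h i, hcast, hJform]
  · simpa only [h] using hsum x
  · refine (hsum x).unique (hasSum_sum_of_ne_finset_zero fun i hi => ?_)
    rw [hF i hi, mul_zero, zero_smul]

end Topological

end PontryaginSpace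

/-! ### Eigenvalues and multiplicities -/

namespace PontryaginSpace

universe u v

variable {κ : ℕ} {E : Type u} [AddCommGroup E] [Module ℂ E] (P : PontryaginSpace κ E)

/-- Installing the norm of `hilbertCore` on `E` makes `IsHilbertInner` true by definition, with the
same topology as `P.topology`. -/
theorem exists_eigenbasis {A : E →ₗ[ℂ] E} (hpos : P.IsPositiveOp A)
    (hc : P.IsCompactOp A) (hinj : ∀ x, A x = 0 → x = 0) :
    (∀ x, x ≠ 0 → 0 < (P.form (A x) x).re) ∧
    ∃ (ι : Type u) (g : ι → E) (μ : ι → ℝ), (∀ i, μ i ≠ 0) ∧ (∀ i, A (g i) = (μ i : ℂ) • g i) ∧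
      (∀ i, P.form (g i) (g i) = if μ i < 0 then -1 else 1) ∧
      (∀ i j, i ≠ j → P.form (g i) (g j) = 0) ∧
      {i | μ i < 0}.encard = κ ∧
      (∀ (x : E) (c : ι → ℂ), (letI := P.topology; HasSum (fun i => c i • g i) x) ↔
        ∀ i, c i = (if μ i < 0 then -1 else 1) * P.form (g i) x) ∧
      ∀ (x : E) (F : Finset ι), (∀ i ∉ F, P.form (g i) x = 0) →
        x = ∑ i ∈ F, ((if μ i < 0 then -1 else 1) * P.form (g i) x) • g i :=
  letI : NormedAddCommGroup E := P.hilbertCore.toNormedAddCommGroup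
  letI : InnerProductSpace ℂ E := InnerProductSpace.ofCore P.hilbertCore.toCore
  have hP : P.IsHilbertInner := fun _ _ => rfl
  hP.exists_eigenbasis hpos hc hinj

/-- An eigenvalue of a strictly positive operator is real and has the sign of the form on
each of its eigenvectors. -/
theorem im_eq_zero_and_pos_of_hasEigenvector {A : E →ₗ[ℂ] E} (hpos : P.IsPositiveOp A)
    (hstrict : ∀ x, x ≠ 0 → 0 < (P.form (A x) x).re) {z : ℂ} {x : E}
    (hx : Module.End.HasEigenvector A z x) : z.im = 0 ∧ 0 < z.re * (P.form x x).re := by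
  have hreal : (P.form x x).im = 0 := Complex.conj_eq_iff_im.1 (P.conj_symm x x)
  have h1 := hstrict x hx.2
  have h2 := (hpos x).1
  rw [hx.apply_eq_smul, LinearMap.map_smulₛₗ, LinearMap.smul_apply, smul_eq_mul] at h1 h2
  simp only [Complex.mul_re, Complex.mul_im, Complex.conj_re, Complex.conj_im, hreal, mul_zero,
    sub_zero, zero_add] at h1 h2
  refine ⟨?_, h1⟩
  have h3 : (P.form x x).re ≠ 0 := fun h => by simp [h] at h1
  simpa [h3] using h2

theorem form_eq_zero_of_eigenvalue_ne {A : E →ₗ[ℂ] E} (hpos : P.IsPositiveOp A)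
    {z w : ℂ} {x y : E} (hz : z.im = 0) (hx : A x = z • x) (hy : A y = w • y) (hzw : z ≠ w) :
    P.form x y = 0 := by
  have h := P.form_map_of_isPositiveOp hpos x y
  rw [hx, hy, LinearMap.map_smulₛₗ, LinearMap.smul_apply, map_smul, smul_eq_mul, smul_eq_mul,
    Complex.conj_eq_iff_im.2 hz, ← sub_eq_zero, ← sub_mul] at h
  exact (mul_eq_zero.1 h).resolve_left (sub_ne_zero.2 hzw)

theorem linearIndependent_of_form {ι : Type v} {g : ι → E} (hself : ∀ i, P.form (g i) (g i) ≠ 0)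
    (horth : ∀ i j, i ≠ j → P.form (g i) (g j) = 0) : LinearIndependent ℂ g := by
  rw [linearIndependent_iff']
  intro s c hc i hi
  have h1 := congrArg (P.form (g i)) hc
  rw [map_sum, map_zero, Finset.sum_eq_single_of_mem i hi fun j _ hj => by
    simp [horth i j hj.symm], map_smul, smul_eq_mul] at h1
  exact (mul_eq_zero.1 h1).resolve_right (hself i)

end PontryaginSpace

theorem mainTheorem3 {κ : ℕ} {E : Type*} [AddCommGroup E] [Module ℂ E]
    (P : PontryaginSpace κ E) (A : E →ₗ[ℂ] E)
    (hpos : P.IsPositiveOp A) (hcompact : P.IsCompactOp A)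
    (hzero : ¬ Module.End.HasEigenvalue A (0 : ℂ)) :
    -- all eigenvalues are real
    (∀ z : ℂ, Module.End.HasEigenvalue A z → z.im = 0) ∧
    -- eigenvectors for distinct eigenvalues are orthogonal
    (∀ (z w : ℂ) (x y : E), Module.End.HasEigenvector A z x → Module.End.HasEigenvector A w y →
      z ≠ w → P.form x y = 0) ∧
    -- some eigenvectors form an orthonormal basis; exactly `κ` of its members have a negative
    -- eigenvalue
    (∃ (S : Set E) (μ : S → ℝ),
      (∀ v : S, Module.End.HasEigenvector A (μ v : ℂ) (v : E)) ∧
      P.IsOrthonormalBasis (fun v : S => (v : E)) ∧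
      {v : S | μ v < 0}.encard = κ) ∧
    -- there are finitely many negative eigenvalues, with multiplicities adding up to `κ`
    (∃ s : Finset ℝ,
      (∀ t : ℝ, t ∈ s ↔ t < 0 ∧ Module.End.HasEigenvalue A (t : ℂ)) ∧
      (∀ t ∈ s, FiniteDimensional ℂ (Module.End.eigenspace A (t : ℂ))) ∧
      ∑ t ∈ s, Module.finrank ℂ (Module.End.eigenspace A (t : ℂ)) = κ) ∧
    -- every eigenvalue is negative with negative eigenvectors or positive with positive ones
    (∀ t : ℝ, Module.End.HasEigenvalue A (t : ℂ) →
      (t < 0 ∧ ∀ x, Module.End.HasEigenvector A (t : ℂ) x → (P.form x x).re < 0) ∨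
      (0 < t ∧ ∀ x, Module.End.HasEigenvector A (t : ℂ) x → 0 < (P.form x x).re)) := by
  classical
  have hinj (x : E) (hx : A x = 0) : x = 0 := by
    by_contra hne
    refine hzero (Module.End.hasEigenvalue_of_hasEigenvector (x := x) ⟨?_, hne⟩)
    rw [Module.End.mem_eigenspace_iff, hx, zero_smul]
  obtain ⟨hstrict, ι, g, μ, hμ, heig, hself, horth, hcard, hsum, hfinsum⟩ :=
    P.exists_eigenbasis hpos hcompact hinj
  have hself_ne (i : ι) : P.form (g i) (g i) ≠ 0 := by
    rw [hself]; split_ifs <;> simp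
  have hvec (i : ι) : Module.End.HasEigenvector A (μ i : ℂ) (g i) :=
    ⟨Module.End.mem_eigenspace_iff.2 (heig i), fun h => hself_ne i (by simp [h])⟩
  refine ⟨fun z hz => ?_, fun z w x y hx hy hzw => ?_, ?_, ?_, fun t ht => ?_⟩
  · obtain ⟨x, hx⟩ := hz.exists_hasEigenvector
    exact (P.im_eq_zero_and_pos_of_hasEigenvector hpos hstrict hx).1
  · exact P.form_eq_zero_of_eigenvalue_ne hpos (P.im_eq_zero_and_pos_of_hasEigenvector hpos hstrict hx).1
      hx.apply_eq_smul hy.apply_eq_smul hzw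
  -- Equal members at distinct indices would be form-orthogonal to themselves, contradicting
  -- `hself_ne`; so the family may be indexed by its range.
  · have hg : Function.Injective g := fun i j hij => by
      by_contra hne
      exact hself_ne i (by conv_lhs => rw [hij, ← hij, hij]
                           rw [← horth i j hne, hij])
    let e : ι ≃ Set.range g := Equiv.ofInjective g hg
    have he (v : Set.range g) : g (e.symm v) = v := Equiv.apply_ofInjective_symm hg v
    have hsum' (x : E) (c : Set.range g → ℂ) :
        (letI := P.topology; HasSum (fun v => c v • (v : E)) x) ↔
          (letI := P.topology; HasSum (fun i => c (e i) • g i) x) :=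
      letI := P.topology
      (e.hasSum_iff (f := fun v => c v • (v : E))).symm
    refine ⟨Set.range g, fun v => μ (e.symm v), fun v => ?_, ⟨fun v w hvw => ?_, fun v => ?_,
      fun x => ?_⟩, ?_⟩
    · have := hvec (e.symm v)
      rwa [he] at this
    · have := horth (e.symm v) (e.symm w) (e.symm.injective.ne hvw)
      rwa [he, he] at this
    · have := hself (e.symm v)
      rw [he] at this
      rw [this]
      split_ifs <;> simp
    · refine ⟨fun v => (if μ (e.symm v) < 0 then -1 else 1) * P.form v x, ?_, fun c hc => ?_⟩
      · refine (hsum' x _).2 ((hsum x _).2 fun i => ?_)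
        rw [e.symm_apply_apply]
        rfl
      · funext v
        have := (hsum x _).1 ((hsum' x c).1 hc) (e.symm v)
        rwa [e.apply_symm_apply, he] at this
    · rw [← hcard, ← e.symm.injective.encard_image]
      congr 1
      ext i
      simp
  · have hfin : {i | μ i < 0}.Finite := Set.finite_of_encard_eq_coe hcard
    have hN (i : ι) : i ∈ hfin.toFinset ↔ μ i < 0 := hfin.mem_toFinset
    have hNcard : hfin.toFinset.card = κ := by
      rw [hfin.encard_eq_coe_toFinset_card] at hcard
      exact_mod_cast hcard
    -- An eigenvector for `t < 0` is form-orthogonal to every `g i` with `μ i ≠ t`, and only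
    -- finitely many indices have `μ i = t`. Its expansion is thus a finite sum, and the eigenspace
    -- is spanned by those `g i`.
    have hexp (t : ℝ) (ht : t < 0) (x : E) (hx : A x = (t : ℂ) • x) :
        x = ∑ i ∈ hfin.toFinset with μ i = t,
          ((if μ i < 0 then -1 else 1) * P.form (g i) x) • g i := by
      refine hfinsum x _ fun i hi => ?_
      refine P.form_eq_zero_of_eigenvalue_ne hpos (Complex.ofReal_im _) (heig i) hx fun h => hi ?_
      have h' : μ i = t := Complex.ofReal_injective h
      rw [Finset.mem_filter, hN, h']
      exact ⟨ht, rfl⟩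
    have hspan (t : ℝ) (ht : t < 0) : Module.End.eigenspace A (t : ℂ) =
        Submodule.span ℂ (Set.range fun i : (hfin.toFinset.filter fun i => μ i = t) => g i) := by
      refine le_antisymm (fun x hx => ?_) (Submodule.span_le.2 ?_)
      · rw [hexp t ht x (Module.End.mem_eigenspace_iff.1 hx)]
        exact Submodule.sum_mem _ fun i hi =>
          Submodule.smul_mem _ _ (Submodule.subset_span ⟨⟨i, hi⟩, rfl⟩)
      · rintro _ ⟨i, rfl⟩
        have := (hvec i).1
        rwa [(Finset.mem_filter.1 i.2).2] at this
    have hneg {t : ℝ} (ht : t ∈ hfin.toFinset.image μ) : t < 0 := by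
      obtain ⟨i, hi, rfl⟩ := Finset.mem_image.1 ht
      exact (hN i).1 hi
    refine ⟨hfin.toFinset.image μ, fun t => ⟨fun ht => ⟨hneg ht, ?_⟩, fun ⟨ht, hev⟩ => ?_⟩,
      fun t ht => ?_, ?_⟩
    · obtain ⟨i, _, rfl⟩ := Finset.mem_image.1 ht
      exact Module.End.hasEigenvalue_of_hasEigenvector (hvec i)
    · obtain ⟨x, hx⟩ := hev.exists_hasEigenvector
      by_contra hmem
      refine hx.2 ?_
      rw [hexp t ht x hx.apply_eq_smul, Finset.filter_eq_empty_iff.2, Finset.sum_empty]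
      exact fun i hi h => hmem (Finset.mem_image.2 ⟨i, hi, h⟩)
    · rw [hspan t (hneg ht)]
      exact FiniteDimensional.span_of_finite ℂ (Set.finite_range _)
    · rw [← hNcard, Finset.card_eq_sum_card_image μ hfin.toFinset]
      refine Finset.sum_congr rfl fun t ht => ?_
      rw [hspan t (hneg ht), finrank_span_eq_card, Fintype.card_coe]
      exact P.linearIndependent_of_form (fun i => hself_ne i)
        fun i j hij => horth i j fun h => hij (Subtype.ext h)
  · have hsign (x : E) (hx : Module.End.HasEigenvector A (t : ℂ) x) : 0 < t * (P.form x x).re :=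
      (P.im_eq_zero_and_pos_of_hasEigenvector hpos hstrict hx).2
    obtain ⟨x, hx⟩ := ht.exists_hasEigenvector
    rcases lt_trichotomy t 0 with h | rfl | h
    · exact Or.inl ⟨h, fun y hy => (mul_pos_iff.1 (hsign y hy)).elim (fun h' => absurd h h'.1.not_gt)
        And.right⟩
    · simpa using hsign x hx
    · exact Or.inr ⟨h, fun y hy => (mul_pos_iff_of_pos_left h).1 (hsign y hy)⟩
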